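/- All graphs are finite, simple and undirected, with edge lengths $\ell:E\to[0,\infty)$, and $d_H$ denotes the shortest-path distance of a graph $H$ (equal to $\infty$ between different components). Let $G=(V,E,\ell)$ be a graph and $R\subseteq V$ a set of terminals. A distance-preserving minor of $G$ with respect to $R$, with vertex set $V'\subseteq V$, is a graph $G'=(V',E',\ell')$ such that (1) $G'$ is a minor of $G$ in which the terminals survive, i.e. $R\subseteq V'$ and there are pairwise disjoint nonempty connected sets $B_v\subseteq V$ ($v\in V'$) such that $t\in B_t$ for each $t\in R$, and for each edge $uv$ of $G'$ some edge of $G$ joins $B_u$ to $B_v$; (2) $d_{G'}(u,v)=d_G(u,v)$ for all $u,v\in R$. Theorem. There is an absolute constant $c>0$ such that for every integer $k\ge 0$ there are a graph $G=(V,E,\ell)$ and a set $R\subseteq V$ of exactly $k$ terminals with the following property: every distance-preserving minor $G'=(V',E',\ell')$ of $G$ with respect to $R$ with $V'\subseteq V$ and $$d_{G'}(u,v)\ge d_G(u,v)\qquad\text{for all }u,v\in V'$$ satisfies $|V'|\ge c\,k^4$. Moreover, $G$ can be taken to be an arrangement of segments of the following form. The terminals are $k$ points in the relative interiors of the four sides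 of the unit square, at least $\lfloor k/4\rfloor$ on each side; every terminal on the top side is joined by a straight segment to every terminal on the bottom side, and every terminal on the left side to every terminal on the right side, and no three of these segments meet in a point that is not a terminal. The vertices of $G$ are the terminals and all points of intersection of two of the segments, two vertices are adjacent if they are consecutive on one of the segments, and the length of an edge is the Euclidean distance between its ends. -/

import Mathlib

open scoped NNReal ENNReal

/-- An undirected simple graph on `V` with nonnegative edge lengths. Only the values of `len` on
edges of the graph are ever used. -/
structure LenGraph (V : Type*) where
  graph : SimpleGraph V
  len : Sym2 V → ℝ≥0

namespace LenGraph

/-- The total length of a walk. -/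
def walkLen {V : Type*} (G : LenGraph V) {u v : V} (p : G.graph.Walk u v) : ℝ≥0 :=
  (p.edges.map G.len).sum

/-- The shortest-path distance (`⊤` if there is no path). -/
noncomputable def d {V : Type*} (G : LenGraph V) (u v : V) : ℝ≥0∞ :=
  ⨅ p : G.graph.Walk u v, (G.walkLen p : ℝ≥0∞)

/-- `G'`, with vertex set `V' ⊆ V`, is a minor of `G` in which the terminals `R` survive: there are
nonempty connected pairwise disjoint branch sets `B v ⊆ V` (`v ∈ V'`), adjacent vertices of `G'` have
branch sets joined by an edge of `G`, and every terminal is a vertex of `G'` that lies in its own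
branch set. The names in `V` of the nonterminal vertices of `G'` are not restricted. -/
def IsMinor {V : Type*} (G : LenGraph V) (R : Finset V) {V' : Finset V} (G' : LenGraph V') : Prop :=
  ∃ B : V' → Set V,
    (∀ v, (G.graph.induce (B v)).Connected) ∧
    (∀ u v, u ≠ v → Disjoint (B u) (B v)) ∧
    (∀ u v, G'.graph.Adj u v → ∃ x ∈ B u, ∃ y ∈ B v, G.graph.Adj x y) ∧
    (∀ t ∈ R, ∃ h : t ∈ V', t ∈ B ⟨t, h⟩)

/-- A distance-preserving minor of `G` with respect to the terminals `R`. -/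
def IsDistPreservingMinor {V : Type*} (G : LenGraph V) (R : Finset V) {V' : Finset V}
    (G' : LenGraph V') : Prop :=
  G.IsMinor R G' ∧ ∀ u v : V', (u : V) ∈ R → (v : V) ∈ R → G'.d u v = G.d u v

/-- All distances in `G'` dominate those in `G`. -/
def Dominates {V : Type*} (G : LenGraph V) {V' : Finset V} (G' : LenGraph V') : Prop :=
  ∀ u v : V', G.d u v ≤ G'.d u v

end LenGraph

/-- The Euclidean plane. -/
abbrev Plane : Type := EuclideanSpace ℝ (Fin 2)

/-- A finite choice of points in the interiors of the four sides of the unit square, each point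
given by its coordinate along the side. -/
structure SquareSides where
  top : Finset ℝ
  bottom : Finset ℝ
  left : Finset ℝ
  right : Finset ℝ
  top_mem : ∀ x ∈ top, x ∈ Set.Ioo (0 : ℝ) 1
  bottom_mem : ∀ x ∈ bottom, x ∈ Set.Ioo (0 : ℝ) 1
  left_mem : ∀ x ∈ left, x ∈ Set.Ioo (0 : ℝ) 1
  right_mem : ∀ x ∈ right, x ∈ Set.Ioo (0 : ℝ) 1

namespace SquareSides

/-- The chosen points on the boundary of the square. -/
def terminals (S : SquareSides) : Set Plane :=
  {q | (∃ x ∈ S.top, q = !₂[x, 1]) ∨ (∃ x ∈ S.bottom, q = !₂[x, 0]) ∨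
    (∃ y ∈ S.left, q = !₂[0, y]) ∨ (∃ y ∈ S.right, q = !₂[1, y])}

/-- The lines, given by their two endpoints: every top terminal is joined to every bottom terminal,
and every left terminal to every right terminal. -/
def lines (S : SquareSides) : Set (Plane × Plane) :=
  {s | (∃ x ∈ S.top, ∃ x' ∈ S.bottom, s = (!₂[x, 1], !₂[x', 0])) ∨
    (∃ y ∈ S.left, ∃ y' ∈ S.right, s = (!₂[0, y], !₂[1, y']))}

/-- The vertices of the arrangement: terminals and points of intersection of two lines. -/
def points (S : SquareSides) : Set Plane :=
  S.terminals ∪ {q | ∃ s ∈ S.lines, ∃ t ∈ S.lines, s ≠ t ∧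
    q ∈ segment ℝ s.1 s.2 ∧ q ∈ segment ℝ t.1 t.2}

/-- No three lines meet in a point other than a terminal. -/
def GeneralPosition (S : SquareSides) : Prop :=
  ∀ s ∈ S.lines, ∀ t ∈ S.lines, ∀ r ∈ S.lines, s ≠ t → s ≠ r → t ≠ r →
    ∀ q, q ∈ segment ℝ s.1 s.2 → q ∈ segment ℝ t.1 t.2 → q ∈ segment ℝ r.1 r.2 → q ∈ S.terminals

/-- `G` with terminals `R`, drawn in the plane by `pos`, is the arrangement of the lines of `S`:
its vertices are the terminals and intersection points, its edges join vertices that are consecutive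
on some line, and the length of an edge is the Euclidean distance of its ends. -/
structure IsArrangement (S : SquareSides) {V : Type*} (G : LenGraph V) (R : Finset V)
    (pos : V → Plane) : Prop where
  injective : Function.Injective pos
  range_eq : Set.range pos = S.points
  terminals_eq : pos '' (R : Set V) = S.terminals
  adj_iff : ∀ u v, G.graph.Adj u v ↔ u ≠ v ∧
    (∃ s ∈ S.lines, pos u ∈ segment ℝ s.1 s.2 ∧ pos v ∈ segment ℝ s.1 s.2) ∧
    ∀ w, ¬ Sbtw ℝ (pos u) (pos w) (pos v)
  len_eq : ∀ u v, G.graph.Adj u v → (G.len s(u, v) : ℝ) = dist (pos u) (pos v)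

end SquareSides

/-- `G` is the arrangement graph, in general position, of the segments joining terminals on opposite
sides of the unit square, where each side carries at least `⌊|R| / 4⌋` of the terminals. -/
def IsGenericSquareArrangement {V : Type*} (G : LenGraph V) (R : Finset V) : Prop :=
  ∃ (S : SquareSides) (pos : V → Plane), S.IsArrangement G R pos ∧ S.GeneralPosition ∧
    R.card / 4 ≤ S.top.card ∧ R.card / 4 ≤ S.bottom.card ∧
    R.card / 4 ≤ S.left.card ∧ R.card / 4 ≤ S.right.card

/-! The two ends of a line are at their Euclidean distance in `G`, and no distance of `G` is below
the Euclidean one. In a dominating distance-preserving minor, a shortest walk between these ends has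
the same length. By domination each vertex on it gives equality in the triangle inequality, so it is
named after a point of the line (`exists_walk_on_line`). Take such walks for a top-bottom line and a
left-right line. Their branch sets span connected parts of the drawing that join opposite sides of
the square, so the two parts meet (`exists_eq_of_crossing_paths`). Edges of the drawing meet only at
common ends, hence the parts share a vertex of `G`. Branch sets are disjoint, so the two walks share
a vertex of the minor, and its name lies on both lines: it is the crossing point
(`exists_vertex_at_crossing`). In general position different pairs of lines have different
crossings, so the minor has at least as many vertices as the product of the four side counts, which
is of order `k ^ 4` (`prod_card_le_card`). General position is reached by adding terminals one at a
time, each avoiding finitely many positions. -/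

/-! ### Topology: crossing paths in a square. -/

open unitInterval in
/-- A continuous logarithm of a path in the closed right half-plane that starts above the real axis
and ends below it has decreased its imaginary part. -/
theorem im_lt_of_exp_eq_of_re_nonneg {L h : I → ℂ} (hL : Continuous L)
    (he : ∀ s, Complex.exp (L s) = h s) (hre : ∀ s, 0 ≤ (h s).re)
    (h0 : 0 < (h 0).im) (h1 : (h 1).im < 0) : (L 1).im < (L 0).im := by
  have hne : ∀ s, h s ≠ 0 := fun s => he s ▸ Complex.exp_ne_zero _
  have hc : Continuous h := by
    have : h = fun s => Complex.exp (L s) := funext fun s => (he s).symm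
    rw [this]; fun_prop
  have hslit : ∀ s, h s ∈ Complex.slitPlane := by
    intro s
    rw [Complex.mem_slitPlane_iff]
    by_contra hcon
    push Not at hcon
    exact hne s (Complex.ext (le_antisymm hcon.1 (hre s)) hcon.2)
  -- The principal logarithm, shifted to agree with `L` at `0`, is another lift of `h` through
  -- `exp`. By uniqueness of lifts it is `L`, so `L` changes by the change in `arg`.
  have hlog : Continuous fun s => Complex.log (h s) + (L 0 - Complex.log (h 0)) :=
    (hc.clog hslit).add continuous_const
  have key := Complex.isCoveringMap_exp.eq_of_comp_eq hL hlog (by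
    funext s
    apply Subtype.ext
    simp only [Function.comp_apply]
    rw [Complex.exp_add, Complex.exp_sub, Complex.exp_log (hne s), Complex.exp_log (hne 0), he, he,
      div_self (hne 0), mul_one]) 0 (by simp)
  have k1 := congrFun key 1
  have : (L 1).im = (h 1).arg + ((L 0).im - (h 0).arg) := by
    rw [k1]; simp [Complex.log_im]
  have a0 : 0 ≤ (h 0).arg := Complex.arg_nonneg_iff.2 h0.le
  have a1 : (h 1).arg < 0 := Complex.arg_neg_iff.2 h1
  linarith

open unitInterval in
/-- In the unit square, a path from the top side to the bottom side meets every path from the left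
side to the right side. -/
theorem exists_eq_of_crossing_paths {t b l r : Plane} (f : Path t b) (g : Path l r)
    (hf : ∀ s i, f s i ∈ Set.Icc (0 : ℝ) 1) (hg : ∀ s i, g s i ∈ Set.Icc (0 : ℝ) 1)
    (ht : t 0 ∈ Set.Ioo (0 : ℝ) 1) (ht1 : t 1 = 1) (hb : b 0 ∈ Set.Ioo (0 : ℝ) 1) (hb1 : b 1 = 0)
    (hl : l 1 ∈ Set.Ioo (0 : ℝ) 1) (hl0 : l 0 = 0) (hr : r 1 ∈ Set.Ioo (0 : ℝ) 1) (hr0 : r 0 = 1) :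
    ∃ s s', f s = g s' := by
  by_contra! hne
  -- The difference `f s - g s'` as a complex number: a nowhere vanishing map on the parameter
  -- square, which therefore has a continuous logarithm.
  let h : C(I × I, ℂ) :=
    ⟨fun p => ((f p.1 0 - g p.2 0 : ℝ) : ℂ) + ((f p.1 1 - g p.2 1 : ℝ) : ℂ) * Complex.I, by
      fun_prop⟩
  have hre : ∀ s s', (h (s, s')).re = f s 0 - g s' 0 := fun s s' => by simp [h]
  have him : ∀ s s', (h (s, s')).im = f s 1 - g s' 1 := fun s s' => by simp [h]
  have hh : ∀ p, h p ∈ ({0}ᶜ : Set ℂ) := by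
    rintro ⟨s, s'⟩ hz
    have e0 := hre s s'
    have e1 := him s s'
    rw [Set.mem_singleton_iff.1 hz] at e0 e1
    apply hne s s'
    ext i
    fin_cases i
    · simpa using (sub_eq_zero.1 e0.symm)
    · simpa using (sub_eq_zero.1 e1.symm)
  -- Clamping the coordinates extends `h` to the whole plane, where the lifting theorem for `exp`
  -- applies.
  let proj : C(ℝ × ℝ, I × I) :=
    ⟨fun p => (Set.projIcc 0 1 zero_le_one p.1, Set.projIcc 0 1 zero_le_one p.2), by fun_prop⟩
  obtain ⟨M, ⟨-, hM⟩, -⟩ := Complex.isCoveringMapOn_exp.existsUnique_continuousMap_lifts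
    (h.comp proj) (a₀ := (0, 0)) (Complex.exp_log (hh _)) fun p => hh (proj p)
  let L : I × I → ℂ := fun p => M ((p.1 : ℝ), (p.2 : ℝ))
  have hLc : Continuous L := by fun_prop
  have hexp : ∀ p, Complex.exp (L p) = h p := fun p => by
    simpa [proj, L] using congrFun hM ((p.1 : ℝ), (p.2 : ℝ))
  -- On each side of the parameter square one of the paths rests at a terminal, so `h` stays in a
  -- closed half-plane. The factor `c` (one of `1`, `I`, `-1`, `-I`) rotates it to the right
  -- half-plane.
  have rot : ∀ (c : ℂ) (hc : c ≠ 0) (γ : I → I × I), Continuous γ →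
      (∀ s, 0 ≤ (c * h (γ s)).re) → 0 < (c * h (γ 0)).im → (c * h (γ 1)).im < 0 →
      (L (γ 1)).im < (L (γ 0)).im := by
    intro c hc γ hγ h1 h2 h3
    have := im_lt_of_exp_eq_of_re_nonneg (L := fun s => Complex.log c + L (γ s))
      (h := fun s => c * h (γ s)) (by fun_prop)
      (fun s => by rw [Complex.exp_add, Complex.exp_log hc, hexp]) h1 h2 h3
    simpa using this
  have s1 := rot 1 one_ne_zero (fun s => (s, 0)) (by fun_prop)
    (fun s => by simp only [one_mul, hre, g.source, hl0]; linarith [(hf s 0).1])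
    (by simp only [one_mul, him, f.source, g.source, ht1]; linarith [hl.2])
    (by simp only [one_mul, him, f.target, g.source, hb1]; linarith [hl.1])
  have s2 := rot Complex.I Complex.I_ne_zero (fun s => (1, s)) (by fun_prop)
    (fun s => by simp only [Complex.I_mul_re, him, f.target, hb1]; linarith [(hg s 1).1])
    (by simp only [Complex.I_mul_im, hre, f.target, g.source, hl0]; linarith [hb.1])
    (by simp only [Complex.I_mul_im, hre, f.target, g.target, hr0]; linarith [hb.2])
  have s3 := rot (-1) (by simp) (fun s => (σ s, 1)) (by fun_prop)
    (fun s => by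
      simp only [neg_mul, one_mul, Complex.neg_re, hre, g.target, hr0]; linarith [(hf (σ s) 0).2])
    (by simp only [neg_mul, one_mul, Complex.neg_im, him, symm_zero, f.target, g.target, hb1]
        linarith [hr.1])
    (by simp only [neg_mul, one_mul, Complex.neg_im, him, symm_one, f.source, g.target, ht1]
        linarith [hr.2])
  have s4 := rot (-Complex.I) (by simp) (fun s => (0, σ s)) (by fun_prop)
    (fun s => by
      simp only [neg_mul, Complex.neg_re, Complex.I_mul_re, him, f.source, ht1]
      linarith [(hg (σ s) 1).2])
    (by simp only [neg_mul, Complex.neg_im, Complex.I_mul_im, hre, symm_zero, f.source, g.target,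
          hr0]
        linarith [ht.2])
    (by simp only [neg_mul, Complex.neg_im, Complex.I_mul_im, hre, symm_one, f.source, g.source,
          hl0]
        linarith [ht.1])
  -- The four sides form a closed loop along which the imaginary part of `L` strictly decreases, a
  -- contradiction.
  simp only [symm_zero, symm_one] at s3 s4
  linarith

/-! ### Shortest-path distances. -/

namespace LenGraph

variable {V : Type*} (G : LenGraph V)

theorem walkLen_append {u v w : V} (p : G.graph.Walk u v) (q : G.graph.Walk v w) :
    G.walkLen (p.append q) = G.walkLen p + G.walkLen q := by
  simp [walkLen, SimpleGraph.Walk.edges_append]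

theorem d_le_walkLen {u v : V} (p : G.graph.Walk u v) : G.d u v ≤ G.walkLen p :=
  iInf_le _ p

theorem d_triangle (u v w : V) : G.d u w ≤ G.d u v + G.d v w := by
  refine ENNReal.le_iInf_add_iInf fun p q => ?_
  rw [← ENNReal.coe_add, ← walkLen_append]
  exact G.d_le_walkLen _

theorem d_le_len {u v : V} (h : G.graph.Adj u v) : G.d u v ≤ G.len s(u, v) := by
  simpa [walkLen] using G.d_le_walkLen h.toWalk

/-- In a finite graph the distance between two joined vertices is attained by a walk. -/
theorem exists_walkLen_eq_d [Finite V] {u v : V} (h : G.d u v ≠ ⊤) :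
    ∃ p : G.graph.Walk u v, (G.walkLen p : ℝ≥0∞) = G.d u v := by
  classical
  have := Fintype.ofFinite V
  have hne : Nonempty (G.graph.Path u v) := by
    by_contra hcon
    apply h
    have : IsEmpty (G.graph.Walk u v) := ⟨fun p => hcon ⟨p.toPath⟩⟩
    simp [d]
  -- There are finitely many paths, and cutting a walk down to a path only drops edges of
  -- nonnegative length.
  obtain ⟨p, hp⟩ := Finite.exists_min fun p : G.graph.Path u v => G.walkLen p.1
  refine ⟨p.1, le_antisymm (le_iInf fun q => ?_) (G.d_le_walkLen _)⟩
  refine ENNReal.coe_le_coe.2 ((hp q.toPath).trans ?_)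
  exact (q.edges_bypass_sublist_edges.map G.len).sum_le_sum (fun _ _ => zero_le)

end LenGraph

/-! ### Coordinates of the lines and their intersections. -/

theorem mem_segment_top_bottom {a b : ℝ} {q : Plane} :
    q ∈ segment ℝ (!₂[a, 1] : Plane) !₂[b, 0] ↔
      q 1 ∈ Set.Icc (0 : ℝ) 1 ∧ q 0 = b + (a - b) * q 1 := by
  constructor
  · rintro ⟨u, v, hu, hv, huv, rfl⟩
    obtain rfl : v = 1 - u := by linarith
    simp only [PiLp.add_apply, PiLp.smul_apply, smul_eq_mul, Matrix.cons_val_zero,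
      Matrix.cons_val_one, Set.mem_Icc]
    refine ⟨⟨by linarith, by linarith⟩, by ring⟩
  · rintro ⟨h, h0⟩
    refine ⟨q 1, 1 - q 1, h.1, by linarith [h.2], by ring, ?_⟩
    ext i
    fin_cases i
    · simp only [Fin.zero_eta, PiLp.add_apply, PiLp.smul_apply, smul_eq_mul, Matrix.cons_val_zero]
      linarith
    · simp

theorem mem_segment_left_right {c d : ℝ} {q : Plane} :
    q ∈ segment ℝ (!₂[0, c] : Plane) !₂[1, d] ↔
      q 0 ∈ Set.Icc (0 : ℝ) 1 ∧ q 1 = c + (d - c) * q 0 := by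
  constructor
  · rintro ⟨u, v, hu, hv, huv, rfl⟩
    obtain rfl : u = 1 - v := by linarith
    simp only [PiLp.add_apply, PiLp.smul_apply, smul_eq_mul, Matrix.cons_val_zero,
      Matrix.cons_val_one, Set.mem_Icc]
    refine ⟨⟨by linarith, by linarith⟩, by ring⟩
  · rintro ⟨h, h0⟩
    refine ⟨1 - q 0, q 0, by linarith [h.2], h.1, by ring, ?_⟩
    ext i
    fin_cases i
    · simp
    · simp only [Fin.mk_one, PiLp.add_apply, PiLp.smul_apply, smul_eq_mul, Matrix.cons_val_one,
        Matrix.cons_val_fin_one]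
      linarith

theorem plane_ext {p q : Plane} (h0 : p 0 = q 0) (h1 : p 1 = q 1) : p = q := by
  ext i
  fin_cases i
  exacts [h0, h1]

theorem convexComb_mem_Ioo {a b y : ℝ} (ha : a ∈ Set.Ioo (0 : ℝ) 1) (hb : b ∈ Set.Ioo (0 : ℝ) 1)
    (hy : y ∈ Set.Icc (0 : ℝ) 1) : b + (a - b) * y ∈ Set.Ioo (0 : ℝ) 1 := by
  have h := (convex_Ioo (0 : ℝ) 1) hb ha (sub_nonneg.2 hy.2) hy.1 (by ring)
  convert h using 1
  simp only [smul_eq_mul]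
  ring

/-- Two affine functions of one variable that agree at two points have the same values at the ends
of the unit interval. -/
theorem affine_eq_of_eq_of_eq {a b a' b' y z : ℝ} (hy : b + (a - b) * y = b' + (a' - b') * y)
    (hz : b + (a - b) * z = b' + (a' - b') * z) (h : y ≠ z) : a = a' ∧ b = b' := by
  have h1 : (a - b - (a' - b')) * (y - z) = 0 := by linarith
  have h2 : a - b - (a' - b') = 0 := by
    simpa [sub_ne_zero.2 h] using h1
  have h3 : (a - b) * y = (a' - b') * y := by
    rw [sub_eq_zero.1 h2]
  constructor <;> linarith

namespace SquareSides

variable (S : SquareSides)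

theorem coord_mem_Ioo_of_crossing {a b c d : ℝ} (ha : a ∈ S.top) (hb : b ∈ S.bottom)
    (hc : c ∈ S.left) (hd : d ∈ S.right) {q : Plane}
    (h : q ∈ segment ℝ (!₂[a, 1] : Plane) !₂[b, 0])
    (h' : q ∈ segment ℝ (!₂[0, c] : Plane) !₂[1, d]) (i : Fin 2) : q i ∈ Set.Ioo (0 : ℝ) 1 := by
  rw [mem_segment_top_bottom] at h
  rw [mem_segment_left_right] at h'
  fin_cases i
  · exact h.2 ▸ convexComb_mem_Ioo (S.top_mem a ha) (S.bottom_mem b hb) h.1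
  · exact h'.2 ▸ convexComb_mem_Ioo (S.right_mem d hd) (S.left_mem c hc) h'.1

/-- With `coord_mem_Ioo_of_crossing`, this rules out the exception for terminals in
`GeneralPosition` at a crossing of a top-bottom and a left-right line. -/
theorem notMem_terminals {q : Plane} (h : ∀ i, q i ∈ Set.Ioo (0 : ℝ) 1) : q ∉ S.terminals := by
  have h0 := h 0
  have h1 := h 1
  rintro (⟨x, -, rfl⟩ | ⟨x, -, rfl⟩ | ⟨x, -, rfl⟩ | ⟨x, -, rfl⟩) <;> simp at h0 h1

/-- On one line the first coordinate has slope `a - b` in the second, on the other the second has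
slope `d - c` in the first. Both slopes are below `1` in absolute value, so the composition is a
contraction and has at most one fixed point. -/
theorem eq_of_crossing {a b c d : ℝ} (ha : a ∈ S.top) (hb : b ∈ S.bottom)
    (hc : c ∈ S.left) (hd : d ∈ S.right) {q q' : Plane}
    (h1 : q ∈ segment ℝ (!₂[a, 1] : Plane) !₂[b, 0])
    (h2 : q ∈ segment ℝ (!₂[0, c] : Plane) !₂[1, d])
    (h3 : q' ∈ segment ℝ (!₂[a, 1] : Plane) !₂[b, 0])
    (h4 : q' ∈ segment ℝ (!₂[0, c] : Plane) !₂[1, d]) : q = q' := by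
  rw [mem_segment_top_bottom] at h1 h3
  rw [mem_segment_left_right] at h2 h4
  have ha := S.top_mem a ha
  have hb := S.bottom_mem b hb
  have hc := S.left_mem c hc
  have hd := S.right_mem d hd
  have e0 : q 0 - q' 0 = (a - b) * (q 1 - q' 1) := by linarith [h1.2, h3.2]
  have e1 : q 1 - q' 1 = (d - c) * (q 0 - q' 0) := by linarith [h2.2, h4.2]
  have hab : |a - b| < 1 := abs_lt.2 ⟨by linarith [ha.1, hb.2], by linarith [ha.2, hb.1]⟩
  have hdc : |d - c| < 1 := abs_lt.2 ⟨by linarith [hd.1, hc.2], by linarith [hd.2, hc.1]⟩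
  have hlt : |(a - b) * (d - c)| < 1 := by
    rw [abs_mul]; exact mul_lt_one_of_nonneg_of_lt_one_left (abs_nonneg _) hab hdc.le
  have hz : (1 - (a - b) * (d - c)) * (q 0 - q' 0) = 0 := by
    rw [e1] at e0; linarith
  have hne : 1 - (a - b) * (d - c) ≠ 0 := by linarith [(abs_lt.1 hlt).2]
  have h0 : q 0 - q' 0 = 0 := by simpa [hne] using hz
  rw [h0, mul_zero] at e1
  exact plane_ext (sub_eq_zero.1 h0) (sub_eq_zero.1 e1)

/-- Two different lines meet in at most one point. -/
theorem eq_of_mem_two_lines {s t : Plane × Plane} (hs : s ∈ S.lines) (ht : t ∈ S.lines)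
    (hst : s ≠ t) {q q' : Plane} (h1 : q ∈ segment ℝ s.1 s.2) (h2 : q ∈ segment ℝ t.1 t.2)
    (h3 : q' ∈ segment ℝ s.1 s.2) (h4 : q' ∈ segment ℝ t.1 t.2) : q = q' := by
  rcases hs with ⟨a, ha, b, hb, rfl⟩ | ⟨c, hc, d, hd, rfl⟩ <;>
    rcases ht with ⟨a', ha', b', hb', rfl⟩ | ⟨c', hc', d', hd', rfl⟩
  · simp only [mem_segment_top_bottom] at h1 h2 h3 h4
    by_cases h : q 1 = q' 1
    · exact plane_ext (by rw [h1.2, h3.2, h]) h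
    · obtain ⟨rfl, rfl⟩ := affine_eq_of_eq_of_eq (h1.2.symm.trans h2.2) (h3.2.symm.trans h4.2) h
      exact absurd rfl hst
  · exact S.eq_of_crossing ha hb hc' hd' h1 h2 h3 h4
  · exact S.eq_of_crossing ha' hb' hc hd h2 h1 h4 h3
  · simp only [mem_segment_left_right] at h1 h2 h3 h4
    by_cases h : q 0 = q' 0
    · exact plane_ext h (by rw [h1.2, h3.2, h])
    · obtain ⟨rfl, rfl⟩ := affine_eq_of_eq_of_eq (h1.2.symm.trans h2.2) (h3.2.symm.trans h4.2) h
      exact absurd rfl hst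

theorem terminals_eq_union : S.terminals =
    (fun x => (!₂[x, 1] : Plane)) '' S.top ∪ ((fun x => (!₂[x, 0] : Plane)) '' S.bottom ∪
      ((fun y => (!₂[0, y] : Plane)) '' S.left ∪ (fun y => (!₂[1, y] : Plane)) '' S.right)) := by
  ext q
  simp [terminals, eq_comm]

theorem finite_terminals : S.terminals.Finite := by
  rw [terminals_eq_union]
  exact (S.top.finite_toSet.image _).union ((S.bottom.finite_toSet.image _).union
    ((S.left.finite_toSet.image _).union (S.right.finite_toSet.image _)))

theorem finite_lines : S.lines.Finite := by
  refine ((S.finite_terminals.prod S.finite_terminals)).subset ?_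
  rintro s (⟨a, ha, b, hb, rfl⟩ | ⟨c, hc, d, hd, rfl⟩)
  · exact ⟨Or.inl ⟨a, ha, rfl⟩, Or.inr (Or.inl ⟨b, hb, rfl⟩)⟩
  · exact ⟨Or.inr (Or.inr (Or.inl ⟨c, hc, rfl⟩)), Or.inr (Or.inr (Or.inr ⟨d, hd, rfl⟩))⟩

theorem finite_points : S.points.Finite := by
  refine S.finite_terminals.union ?_
  have : (⋃ s ∈ S.lines, ⋃ t ∈ S.lines,
      {q | s ≠ t ∧ q ∈ segment ℝ s.1 s.2 ∧ q ∈ segment ℝ t.1 t.2}).Finite := by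
    refine S.finite_lines.biUnion fun s hs => S.finite_lines.biUnion fun t ht => ?_
    refine Set.Subsingleton.finite fun q hq q' hq' => ?_
    exact S.eq_of_mem_two_lines hs ht hq.1 hq.2.1 hq.2.2 hq'.2.1 hq'.2.2
  refine this.subset ?_
  rintro q ⟨s, hs, t, ht, h⟩
  simp only [Set.mem_iUnion]
  exact ⟨s, hs, t, ht, h⟩

/-- No terminal is a corner of the square, so the four families are disjoint. -/
theorem ncard_terminals :
    S.terminals.ncard = S.top.card + S.bottom.card + S.left.card + S.right.card := by
  have hinj1 : ∀ z : ℝ, Function.Injective fun x : ℝ => (!₂[x, z] : Plane) := fun z x y h => by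
    simpa using congrArg (fun p : Plane => p 0) h
  have hinj2 : ∀ z : ℝ, Function.Injective fun x : ℝ => (!₂[z, x] : Plane) := fun z x y h => by
    simpa using congrArg (fun p : Plane => p 1) h
  have hR := S.right.finite_toSet.image fun y => (!₂[1, y] : Plane)
  have hL := S.left.finite_toSet.image fun y => (!₂[0, y] : Plane)
  have hB := S.bottom.finite_toSet.image fun x => (!₂[x, 0] : Plane)
  have hT := S.top.finite_toSet.image fun x => (!₂[x, 1] : Plane)
  rw [terminals_eq_union, Set.ncard_union_eq _ hT (hB.union (hL.union hR)),
    Set.ncard_union_eq _ hB (hL.union hR), Set.ncard_union_eq _ hL hR,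
    Set.ncard_image_of_injective _ (hinj1 1), Set.ncard_image_of_injective _ (hinj1 0),
    Set.ncard_image_of_injective _ (hinj2 0), Set.ncard_image_of_injective _ (hinj2 1)]
  · simp only [Set.ncard_coe_finset]; ring
  · rw [Set.disjoint_left]
    rintro _ ⟨x, hx, rfl⟩ ⟨y, hy, h⟩
    simpa using congrArg (fun p : Plane => p 0) h
  · rw [Set.disjoint_left]
    rintro _ ⟨x, hx, rfl⟩ (⟨y, hy, h⟩ | ⟨y, hy, h⟩)
    · have := congrArg (fun p : Plane => p 0) h
      have := (S.bottom_mem x hx).1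
      simp_all
    · have := congrArg (fun p : Plane => p 0) h
      have := (S.bottom_mem x hx).2
      simp_all
  · rw [Set.disjoint_left]
    rintro _ ⟨x, hx, rfl⟩ (⟨y, hy, h⟩ | ⟨y, hy, h⟩ | ⟨y, hy, h⟩)
    · simpa using congrArg (fun p : Plane => p 1) h
    · have := congrArg (fun p : Plane => p 0) h
      have := (S.top_mem x hx).1
      simp_all
    · have := congrArg (fun p : Plane => p 0) h
      have := (S.top_mem x hx).2
      simp_all

theorem coord_mem_Icc_of_mem_line {s : Plane × Plane} (hs : s ∈ S.lines) {q : Plane}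
    (hq : q ∈ segment ℝ s.1 s.2) (i : Fin 2) : q i ∈ Set.Icc (0 : ℝ) 1 := by
  rcases hs with ⟨a, ha, b, hb, rfl⟩ | ⟨c, hc, d, hd, rfl⟩
  · rw [mem_segment_top_bottom] at hq
    fin_cases i
    · exact hq.2 ▸ Set.Ioo_subset_Icc_self
        (convexComb_mem_Ioo (S.top_mem a ha) (S.bottom_mem b hb) hq.1)
    · exact hq.1
  · rw [mem_segment_left_right] at hq
    fin_cases i
    · exact hq.1
    · exact hq.2 ▸ Set.Ioo_subset_Icc_self
        (convexComb_mem_Ioo (S.right_mem d hd) (S.left_mem c hc) hq.1)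

/-! ### Existence of arrangements in general position. -/

variable {S}

/-- If a terminal `p z` is added to an arrangement in general position, then the new arrangement is
in general position for all but finitely many positions `z`. -/
theorem GeneralPosition.exists_extension (hS : S.GeneralPosition)
    (T : Set.Ioo (0 : ℝ) 1 → SquareSides) (p : ℝ → Plane) (E : Set Plane) (hE : E ⊆ S.terminals)
    (hp : ∀ z, p z ∈ (T z).terminals) (hT : ∀ z, S.terminals ⊆ (T z).terminals)
    (hlines : ∀ z, ∀ s ∈ (T z).lines,
      s ∈ S.lines ∨ ∃ e ∈ E, segment ℝ s.1 s.2 = segment ℝ (p z) e)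
    (hinj : ∀ e ∈ E, ∀ z z' q, q ∈ segment ℝ (p z) e → q ∈ segment ℝ (p z') e → q ≠ e → z = z')
    (F : Finset ℝ) : ∃ z : Set.Ioo (0 : ℝ) 1, (z : ℝ) ∉ F ∧ (T z).GeneralPosition := by
  -- Bad positions are those where a new line passes through an old vertex other than its old end
  -- `e`. By `hinj` each pair of `e` and `q` excludes at most one `z`.
  have hbad : (⋃ e ∈ E, ⋃ q ∈ S.points, {z | q ∈ segment ℝ (p z) e ∧ q ≠ e}).Finite := by
    refine (S.finite_terminals.subset hE).biUnion fun e he => S.finite_points.biUnion fun q _ => ?_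
    exact Set.Subsingleton.finite fun z hz z' hz' => hinj e he z z' q hz.1 hz'.1 hz.2
  obtain ⟨z, hz, hzF⟩ := ((Set.Ioo_infinite (zero_lt_one (α := ℝ))).sdiff
    (F.finite_toSet.union hbad)).nonempty
  rw [Set.mem_union, not_or] at hzF
  refine ⟨⟨z, hz⟩, fun h => hzF.1 h, ?_⟩
  have hgood : ∀ e ∈ E, ∀ q ∈ S.points, q ∈ segment ℝ (p z) e → q = e := by
    intro e he q hq h
    by_contra hne
    apply hzF.2
    simp only [Set.mem_iUnion]
    exact ⟨e, he, q, hq, h, hne⟩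
  -- Two new lines already share the new terminal `p z`, so they meet nowhere else.
  have two : ∀ s ∈ (T ⟨z, hz⟩).lines, ∀ t ∈ (T ⟨z, hz⟩).lines, s ≠ t →
      (∃ e ∈ E, segment ℝ s.1 s.2 = segment ℝ (p z) e) →
      (∃ e ∈ E, segment ℝ t.1 t.2 = segment ℝ (p z) e) →
      ∀ q, q ∈ segment ℝ s.1 s.2 → q ∈ segment ℝ t.1 t.2 → q ∈ (T ⟨z, hz⟩).terminals := by
    rintro s hs t ht hst ⟨e, -, h1⟩ ⟨e', -, h2⟩ q hqs hqt
    have : q = p z := (T ⟨z, hz⟩).eq_of_mem_two_lines hs ht hst hqs hqt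
      (h1 ▸ left_mem_segment ℝ _ _) (h2 ▸ left_mem_segment ℝ _ _)
    exact this ▸ hp ⟨z, hz⟩
  -- A point on two old lines is an old vertex, so a new line can contain it only at its old end, a
  -- terminal.
  have one : ∀ s : Plane × Plane, (∃ e ∈ E, segment ℝ s.1 s.2 = segment ℝ (p z) e) → ∀ t ∈ S.lines,
      ∀ r ∈ S.lines, t ≠ r → ∀ q, q ∈ segment ℝ s.1 s.2 → q ∈ segment ℝ t.1 t.2 →
      q ∈ segment ℝ r.1 r.2 → q ∈ (T ⟨z, hz⟩).terminals := by
    rintro s ⟨e, he, h1⟩ t ht r hr htr q hqs hqt hqr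
    have : q = e := hgood e he q (Or.inr ⟨t, ht, r, hr, htr, hqt, hqr⟩) (h1 ▸ hqs)
    exact this ▸ hT _ (hE he)
  intro s hs t ht r hr hst hsr htr q hqs hqt hqr
  rcases hlines _ s hs with s1 | s1 <;> rcases hlines _ t ht with t1 | t1 <;>
    rcases hlines _ r hr with r1 | r1
  · exact hT _ (hS s s1 t t1 r r1 hst hsr htr q hqs hqt hqr)
  · exact one r r1 s s1 t t1 hst q hqr hqs hqt
  · exact one t t1 s s1 r r1 hsr q hqt hqs hqr
  · exact two t ht r hr htr t1 r1 q hqt hqr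
  · exact one s s1 t t1 r r1 htr q hqs hqt hqr
  · exact two s hs r hr hsr s1 r1 q hqs hqr
  · exact two s hs t ht hst s1 t1 q hqs hqt
  · exact two s hs t ht hst s1 t1 q hqs hqt

/-- The new lines run from the new point to the bottom terminals. A point of such a line other than
its bottom end determines the top end, which is the injectivity that `exists_extension` needs. The
other three sides are analogous. -/
theorem GeneralPosition.exists_insert_top (hS : S.GeneralPosition) :
    ∃ T : SquareSides, T.GeneralPosition ∧ T.top.card = S.top.card + 1 ∧ T.bottom = S.bottom ∧
      T.left = S.left ∧ T.right = S.right := by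
  obtain ⟨z, hz, h⟩ := hS.exists_extension
    (fun z => { S with
      top := insert z.1 S.top
      top_mem := (Finset.forall_mem_insert _ _ _).2 ⟨z.2, S.top_mem⟩ })
    (fun x => !₂[x, 1]) {q | ∃ x ∈ S.bottom, q = !₂[x, 0]}
    (fun q hq => Or.inr (Or.inl hq))
    (fun z => Or.inl ⟨z, Finset.mem_insert_self _ _, rfl⟩)
    (fun z q => Or.imp_left fun ⟨x, hx, h⟩ => ⟨x, Finset.mem_insert_of_mem hx, h⟩)
    (by
      rintro z s (⟨a, ha, b, hb, rfl⟩ | h)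
      · rcases Finset.mem_insert.1 ha with rfl | ha
        · exact Or.inr ⟨_, ⟨b, hb, rfl⟩, rfl⟩
        · exact Or.inl (Or.inl ⟨a, ha, b, hb, rfl⟩)
      · exact Or.inl (Or.inr h))
    (by
      rintro _ ⟨b, -, rfl⟩ z z' q h1 h2 hne
      simp only [mem_segment_top_bottom] at h1 h2
      have hq : q 1 ≠ 0 := fun h => hne (plane_ext (by simp [h1.2, h]) (by simp [h]))
      have := mul_right_cancel₀ hq (add_left_cancel (h1.2.symm.trans h2.2))
      linarith)
    S.top
  exact ⟨_, h, Finset.card_insert_of_notMem hz, rfl, rfl, rfl⟩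

theorem GeneralPosition.exists_insert_bottom (hS : S.GeneralPosition) :
    ∃ T : SquareSides, T.GeneralPosition ∧ T.top = S.top ∧ T.bottom.card = S.bottom.card + 1 ∧
      T.left = S.left ∧ T.right = S.right := by
  obtain ⟨z, hz, h⟩ := hS.exists_extension
    (fun z => { S with
      bottom := insert z.1 S.bottom
      bottom_mem := (Finset.forall_mem_insert _ _ _).2 ⟨z.2, S.bottom_mem⟩ })
    (fun x => !₂[x, 0]) {q | ∃ x ∈ S.top, q = !₂[x, 1]}
    (fun q hq => Or.inl hq)
    (fun z => Or.inr (Or.inl ⟨z, Finset.mem_insert_self _ _, rfl⟩))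
    (fun z q => Or.imp_right <| Or.imp_left fun ⟨x, hx, h⟩ => ⟨x, Finset.mem_insert_of_mem hx, h⟩)
    (by
      rintro z s (⟨a, ha, b, hb, rfl⟩ | h)
      · rcases Finset.mem_insert.1 hb with rfl | hb
        · exact Or.inr ⟨_, ⟨a, ha, rfl⟩, segment_symm _ _ _⟩
        · exact Or.inl (Or.inl ⟨a, ha, b, hb, rfl⟩)
      · exact Or.inl (Or.inr h))
    (by
      rintro _ ⟨a, -, rfl⟩ z z' q h1 h2 hne
      simp only [segment_symm ℝ (!₂[_, 0] : Plane), mem_segment_top_bottom] at h1 h2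
      have hq : 1 - q 1 ≠ 0 := fun h => hne
        (plane_ext (by simp [h1.2, ← sub_eq_zero.1 h]) (by simp [← sub_eq_zero.1 h]))
      exact mul_right_cancel₀ hq (by linarith [h1.2, h2.2]))
    S.bottom
  exact ⟨_, h, rfl, Finset.card_insert_of_notMem hz, rfl, rfl⟩

theorem GeneralPosition.exists_insert_left (hS : S.GeneralPosition) :
    ∃ T : SquareSides, T.GeneralPosition ∧ T.top = S.top ∧ T.bottom = S.bottom ∧
      T.left.card = S.left.card + 1 ∧ T.right = S.right := by
  obtain ⟨z, hz, h⟩ := hS.exists_extension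
    (fun z => { S with
      left := insert z.1 S.left
      left_mem := (Finset.forall_mem_insert _ _ _).2 ⟨z.2, S.left_mem⟩ })
    (fun x => !₂[0, x]) {q | ∃ x ∈ S.right, q = !₂[1, x]}
    (fun q hq => Or.inr (Or.inr (Or.inr hq)))
    (fun z => Or.inr (Or.inr (Or.inl ⟨z, Finset.mem_insert_self _ _, rfl⟩)))
    (fun z q => Or.imp_right <| Or.imp_right <| Or.imp_left
      fun ⟨x, hx, h⟩ => ⟨x, Finset.mem_insert_of_mem hx, h⟩)
    (by
      rintro z s (h | ⟨c, hc, d, hd, rfl⟩)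
      · exact Or.inl (Or.inl h)
      · rcases Finset.mem_insert.1 hc with rfl | hc
        · exact Or.inr ⟨_, ⟨d, hd, rfl⟩, rfl⟩
        · exact Or.inl (Or.inr ⟨c, hc, d, hd, rfl⟩))
    (by
      rintro _ ⟨d, -, rfl⟩ z z' q h1 h2 hne
      simp only [mem_segment_left_right] at h1 h2
      have hq : 1 - q 0 ≠ 0 := fun h => hne
        (plane_ext (by simp [← sub_eq_zero.1 h]) (by simp [h1.2, ← sub_eq_zero.1 h]))
      exact mul_right_cancel₀ hq (by linarith [h1.2, h2.2]))
    S.left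
  exact ⟨_, h, rfl, rfl, Finset.card_insert_of_notMem hz, rfl⟩

theorem GeneralPosition.exists_insert_right (hS : S.GeneralPosition) :
    ∃ T : SquareSides, T.GeneralPosition ∧ T.top = S.top ∧ T.bottom = S.bottom ∧
      T.left = S.left ∧ T.right.card = S.right.card + 1 := by
  obtain ⟨z, hz, h⟩ := hS.exists_extension
    (fun z => { S with
      right := insert z.1 S.right
      right_mem := (Finset.forall_mem_insert _ _ _).2 ⟨z.2, S.right_mem⟩ })
    (fun x => !₂[1, x]) {q | ∃ x ∈ S.left, q = !₂[0, x]}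
    (fun q hq => Or.inr (Or.inr (Or.inl hq)))
    (fun z => Or.inr (Or.inr (Or.inr ⟨z, Finset.mem_insert_self _ _, rfl⟩)))
    (fun z q => Or.imp_right <| Or.imp_right <| Or.imp_right
      fun ⟨x, hx, h⟩ => ⟨x, Finset.mem_insert_of_mem hx, h⟩)
    (by
      rintro z s (h | ⟨c, hc, d, hd, rfl⟩)
      · exact Or.inl (Or.inl h)
      · rcases Finset.mem_insert.1 hd with rfl | hd
        · exact Or.inr ⟨_, ⟨c, hc, rfl⟩, segment_symm _ _ _⟩
        · exact Or.inl (Or.inr ⟨c, hc, d, hd, rfl⟩))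
    (by
      rintro _ ⟨c, -, rfl⟩ z z' q h1 h2 hne
      simp only [segment_symm ℝ (!₂[1, _] : Plane), mem_segment_left_right] at h1 h2
      have hq : q 0 ≠ 0 := fun h => hne (plane_ext (by simp [h]) (by simp [h1.2, h]))
      have := mul_right_cancel₀ hq (add_left_cancel (h1.2.symm.trans h2.2))
      linarith)
    S.right
  exact ⟨_, h, rfl, rfl, rfl, Finset.card_insert_of_notMem hz⟩

/-- There are arrangements in general position with any prescribed numbers of terminals. -/
theorem exists_generalPosition (n₁ n₂ n₃ n₄ : ℕ) :
    ∃ S : SquareSides, S.GeneralPosition ∧ S.top.card = n₁ ∧ S.bottom.card = n₂ ∧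
      S.left.card = n₃ ∧ S.right.card = n₄ := by
  induction n₁ with
  | succ n ih =>
    obtain ⟨S, hS, h1, h2, h3, h4⟩ := ih
    obtain ⟨T, hT, e1, e2, e3, e4⟩ := hS.exists_insert_top
    exact ⟨T, hT, by rw [e1, h1], by rw [e2, h2], by rw [e3, h3], by rw [e4, h4]⟩
  | zero =>
  induction n₂ with
  | succ n ih =>
    obtain ⟨S, hS, h1, h2, h3, h4⟩ := ih
    obtain ⟨T, hT, e1, e2, e3, e4⟩ := hS.exists_insert_bottom
    exact ⟨T, hT, by rw [e1, h1], by rw [e2, h2], by rw [e3, h3], by rw [e4, h4]⟩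
  | zero =>
  induction n₃ with
  | succ n ih =>
    obtain ⟨S, hS, h1, h2, h3, h4⟩ := ih
    obtain ⟨T, hT, e1, e2, e3, e4⟩ := hS.exists_insert_left
    exact ⟨T, hT, by rw [e1, h1], by rw [e2, h2], by rw [e3, h3], by rw [e4, h4]⟩
  | zero =>
  induction n₄ with
  | succ n ih =>
    obtain ⟨S, hS, h1, h2, h3, h4⟩ := ih
    obtain ⟨T, hT, e1, e2, e3, e4⟩ := hS.exists_insert_right
    exact ⟨T, hT, by rw [e1, h1], by rw [e2, h2], by rw [e3, h3], by rw [e4, h4]⟩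
  | zero =>
    refine ⟨⟨∅, ∅, ∅, ∅, by simp, by simp, by simp, by simp⟩, ?_, rfl, rfl, rfl, rfl⟩
    rintro s (⟨x, hx, -⟩ | ⟨x, hx, -⟩) <;> simp at hx

end SquareSides

/-! ### The arrangement graph and the overlap of collinear segments. -/

/-- If two intervals of the line meet, then one of them contains an end of the other. -/
theorem exists_end_mem_uIcc {a b c d t : ℝ} (h : t ∈ Set.uIcc a b) (h' : t ∈ Set.uIcc c d) :
    a ∈ Set.uIcc c d ∨ b ∈ Set.uIcc c d ∨ c ∈ Set.uIcc a b ∨ d ∈ Set.uIcc a b := by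
  simp only [Set.mem_uIcc] at *
  by_contra! hcon
  rcases h with h | h <;> rcases h' with h' | h' <;> grind

/-- If two subsegments of a nondegenerate segment meet, then one of them contains an end of the
other. -/
theorem exists_end_mem_segment {E : Type*} [AddCommGroup E] [Module ℝ E] {p q a b c d z : E}
    (hpq : p ≠ q) (ha : a ∈ segment ℝ p q) (hb : b ∈ segment ℝ p q) (hc : c ∈ segment ℝ p q)
    (hd : d ∈ segment ℝ p q) (h : z ∈ segment ℝ a b) (h' : z ∈ segment ℝ c d) :
    a ∈ segment ℝ c d ∨ b ∈ segment ℝ c d ∨ c ∈ segment ℝ a b ∨ d ∈ segment ℝ a b := by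
  rw [segment_eq_image_lineMap] at ha hb hc hd
  obtain ⟨ta, -, rfl⟩ := ha
  obtain ⟨tb, -, rfl⟩ := hb
  obtain ⟨tc, -, rfl⟩ := hc
  obtain ⟨td, -, rfl⟩ := hd
  have hinj := AffineMap.lineMap_injective ℝ hpq
  simp only [← image_segment, segment_eq_uIcc] at *
  obtain ⟨t, ht, rfl⟩ := h
  obtain ⟨t', ht', he⟩ := h'
  obtain rfl := hinj he
  simpa only [hinj.mem_set_image] using exists_end_mem_uIcc ht ht'

namespace SquareSides

variable (S : SquareSides)

theorem ne_of_mem_lines {s : Plane × Plane} (hs : s ∈ S.lines) : s.1 ≠ s.2 := by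
  rcases hs with ⟨a, ha, b, hb, rfl⟩ | ⟨c, hc, d, hd, rfl⟩ <;> intro h
  · simpa using congrArg (fun p : Plane => p 1) h
  · simpa using congrArg (fun p : Plane => p 0) h

theorem coord_mem_Icc_of_mem_points {q : Plane} (hq : q ∈ S.points) (i : Fin 2) :
    q i ∈ Set.Icc (0 : ℝ) 1 := by
  rcases hq with hq | ⟨s, hs, t, ht, -, hq, -⟩
  · rcases hq with ⟨x, hx, rfl⟩ | ⟨x, hx, rfl⟩ | ⟨x, hx, rfl⟩ | ⟨x, hx, rfl⟩
    · have := S.top_mem x hx; fin_cases i <;> simp [this.1.le, this.2.le]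
    · have := S.bottom_mem x hx; fin_cases i <;> simp [this.1.le, this.2.le]
    · have := S.left_mem x hx; fin_cases i <;> simp [this.1.le, this.2.le]
    · have := S.right_mem x hx; fin_cases i <;> simp [this.1.le, this.2.le]
  · exact S.coord_mem_Icc_of_mem_line hs hq i

/-- The arrangement graph of the lines of `S`. -/
noncomputable def arrangement : LenGraph S.points where
  graph :=
    { Adj := fun u v => u ≠ v ∧
        (∃ s ∈ S.lines, (u : Plane) ∈ segment ℝ s.1 s.2 ∧ (v : Plane) ∈ segment ℝ s.1 s.2) ∧
        ∀ w : S.points, ¬ Sbtw ℝ (u : Plane) w v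
      symm := ⟨fun _ _ ⟨h1, ⟨s, hs, hu, hv⟩, h3⟩ =>
        ⟨h1.symm, ⟨s, hs, hv, hu⟩, fun w hw => h3 w (sbtw_comm.1 hw)⟩⟩
      loopless := ⟨fun _ h => h.1 rfl⟩ }
  len := Sym2.lift ⟨fun u v => nndist (u : Plane) v, fun _ _ => nndist_comm _ _⟩

theorem isArrangement_arrangement (R : Finset S.points)
    (hR : ∀ u, u ∈ R ↔ (u : Plane) ∈ S.terminals) :
    S.IsArrangement S.arrangement R Subtype.val where
  injective := Subtype.val_injective
  range_eq := Subtype.range_val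
  terminals_eq := by
    ext q
    constructor
    · rintro ⟨u, hu, rfl⟩
      exact (hR u).1 hu
    · intro hq
      exact ⟨⟨q, Or.inl hq⟩, (hR _).2 hq, rfl⟩
  adj_iff _ _ := Iff.rfl
  len_eq _ _ _ := rfl

end SquareSides

/-! ### Connectedness of drawings of branch sets. -/

/-- The part of the drawing of `G` spanned by a set of vertices. -/
def LenGraph.drawing {V : Type*} (G : LenGraph V) (pos : V → Plane) (X : Set V) : Set Plane :=
  {z | ∃ x ∈ X, ∃ y ∈ X, (x = y ∨ G.graph.Adj x y) ∧ z ∈ segment ℝ (pos x) (pos y)}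

namespace LenGraph

variable {V : Type*} (G : LenGraph V) (pos : V → Plane)

theorem drawing_mono {X Y : Set V} (h : X ⊆ Y) : G.drawing pos X ⊆ G.drawing pos Y :=
  fun _ ⟨x, hx, y, hy, hz⟩ => ⟨x, h hx, y, h hy, hz⟩

theorem mem_drawing {X : Set V} {x : V} (hx : x ∈ X) : pos x ∈ G.drawing pos X :=
  ⟨x, hx, x, hx, Or.inl rfl, left_mem_segment ℝ _ _⟩

theorem joinedIn_drawing_of_adj {X : Set V} {x y : V} (hx : x ∈ X) (hy : y ∈ X)
    (h : G.graph.Adj x y) : JoinedIn (G.drawing pos X) (pos x) (pos y) :=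
  JoinedIn.of_segment_subset fun _ hz => ⟨x, hx, y, hy, Or.inr h, hz⟩

theorem joinedIn_drawing_of_walk {X : Set V} {x y : X} (p : (G.graph.induce X).Walk x y) :
    JoinedIn (G.drawing pos X) (pos x) (pos y) := by
  induction p with
  | nil => exact JoinedIn.refl (G.mem_drawing pos (Subtype.prop _))
  | cons h _ ih =>
    exact (G.joinedIn_drawing_of_adj pos (Subtype.prop _) (Subtype.prop _) h).trans ih

/-- A walk in a minor spans a connected part of the drawing of the graph. -/
theorem joinedIn_drawing_of_minor_walk {V' : Type*} {G' : LenGraph V'} {B : V' → Set V}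
    (hconn : ∀ v, (G.graph.induce (B v)).Connected)
    (hadj : ∀ u v, G'.graph.Adj u v → ∃ x ∈ B u, ∃ y ∈ B v, G.graph.Adj x y)
    {u v : V'} (p : G'.graph.Walk u v) {x y : V} (hx : x ∈ B u) (hy : y ∈ B v) :
    JoinedIn (G.drawing pos (⋃ w ∈ p.support, B w)) (pos x) (pos y) := by
  have branch : ∀ v, ∀ x ∈ B v, ∀ y ∈ B v, ∀ X, B v ⊆ X →
      JoinedIn (G.drawing pos X) (pos x) (pos y) := by
    intro v x hx y hy X hX
    obtain ⟨p⟩ := (hconn v).preconnected ⟨x, hx⟩ ⟨y, hy⟩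
    exact (G.joinedIn_drawing_of_walk pos p).mono (G.drawing_mono pos hX)
  induction p generalizing x with
  | nil => exact branch _ x hx y hy _ (by simp)
  | @cons u u' v h p ih =>
    obtain ⟨x', hx', y', hy', hadj'⟩ := hadj _ _ h
    have hu : B u ⊆ ⋃ w ∈ (SimpleGraph.Walk.cons h p).support, B w :=
      Set.subset_biUnion_of_mem (u := B) (SimpleGraph.Walk.start_mem_support _)
    have hp : (⋃ w ∈ p.support, B w) ⊆ ⋃ w ∈ (SimpleGraph.Walk.cons h p).support, B w :=
      Set.biUnion_subset_biUnion_left fun w hw =>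
        List.mem_cons_of_mem u hw
    have hy'' : y' ∈ ⋃ w ∈ (SimpleGraph.Walk.cons h p).support, B w :=
      hp (Set.mem_biUnion p.start_mem_support hy')
    exact ((branch u x hx x' hx' _ hu).trans
      (G.joinedIn_drawing_of_adj pos (hu hx') hy'' hadj')).trans
      ((ih hy' hy).mono (G.drawing_mono pos hp))

end LenGraph

/-! ### Metric and planar properties of arrangements, and the lower bound. -/

namespace SquareSides.IsArrangement

variable {S : SquareSides} {V : Type*} {G : LenGraph V} {R : Finset V} {pos : V → Plane}

theorem len_eq_nndist (hA : S.IsArrangement G R pos) {u v : V} (h : G.graph.Adj u v) :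
    G.len s(u, v) = nndist (pos u) (pos v) :=
  NNReal.eq (hA.len_eq u v h)

/-- Edges are as long as the straight segments they are drawn as, so this is the triangle inequality
along a walk. -/
theorem nndist_le_d (hA : S.IsArrangement G R pos)
    (u v : V) : (nndist (pos u) (pos v) : ℝ≥0∞) ≤ G.d u v := by
  refine le_iInf fun p => ENNReal.coe_le_coe.2 ?_
  induction p with
  | nil => simp
  | @cons u v w h p ih =>
    have : G.walkLen (SimpleGraph.Walk.cons h p) = G.len s(u, v) + G.walkLen p := by
      simp [LenGraph.walkLen]
    rw [this, hA.len_eq_nndist h]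
    exact (nndist_triangle _ (pos v) _).trans (by gcongr)

/-- The distance of two vertices on a common line is at most their Euclidean distance. -/
theorem d_le_nndist (hA : S.IsArrangement G R pos)
    [Finite V] {s : Plane × Plane} (hs : s ∈ S.lines) {u v : V}
    (hu : pos u ∈ segment ℝ s.1 s.2) (hv : pos v ∈ segment ℝ s.1 s.2) :
    G.d u v ≤ nndist (pos u) (pos v) := by
  -- Induction on the number of vertices strictly between `u` and `v`: any such vertex splits the
  -- segment into two with fewer, and if there is none then `u` and `v` are equal or adjacent.
  induction hn : {w | Sbtw ℝ (pos u) (pos w) (pos v)}.ncard using Nat.strong_induction_on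
    generalizing u v with
  | _ n ih =>
    subst hn
    by_cases huv : u = v
    · subst huv
      simpa [LenGraph.walkLen] using G.d_le_walkLen (SimpleGraph.Walk.nil : G.graph.Walk u u)
    by_cases hb : ∃ w, Sbtw ℝ (pos u) (pos w) (pos v)
    · obtain ⟨w, hw⟩ := hb
      have hwl : pos w ∈ segment ℝ s.1 s.2 :=
        (convex_segment _ _).segment_subset hu hv hw.wbtw.mem_segment
      have h1 := ih _ (Set.ncard_lt_ncard (t := {w | Sbtw ℝ (pos u) (pos w) (pos v)})
        ⟨fun x hx => hw.wbtw.trans_sbtw_left hx, fun h => (h hw).2.2 rfl⟩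
        (Set.toFinite _)) hu hwl rfl
      have h2 := ih _ (Set.ncard_lt_ncard (t := {w | Sbtw ℝ (pos u) (pos w) (pos v)})
        ⟨fun x hx => hw.wbtw.trans_sbtw_right hx, fun h => (h hw).2.1 rfl⟩
        (Set.toFinite _)) hwl hv rfl
      refine (G.d_triangle u w v).trans ((add_le_add h1 h2).trans (le_of_eq ?_))
      rw [← ENNReal.coe_add, ENNReal.coe_inj]
      exact NNReal.eq hw.wbtw.dist_add_dist
    · push Not at hb
      have hadj : G.graph.Adj u v := (hA.adj_iff u v).2 ⟨huv, ⟨s, hs, hu, hv⟩, hb⟩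
      exact hA.len_eq_nndist hadj ▸ G.d_le_len hadj

/-- An edge contains no vertices besides its ends. -/
theorem eq_or_eq_of_mem_edge (hA : S.IsArrangement G R pos)
    {x y w : V} (h : x = y ∨ G.graph.Adj x y)
    (hw : pos w ∈ segment ℝ (pos x) (pos y)) : w = x ∨ w = y := by
  rcases h with rfl | h
  · rw [segment_same] at hw
    exact Or.inl (hA.injective hw)
  · by_contra! hcon
    exact ((hA.adj_iff x y).1 h).2.2 w ⟨mem_segment_iff_wbtw.1 hw,
      fun e => hcon.1 (hA.injective e), fun e => hcon.2 (hA.injective e)⟩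

/-- Edges that meet have a common end. -/
theorem exists_common_end (hA : S.IsArrangement G R pos)
    {x₁ x₂ y₁ y₂ : V} (hx : x₁ = x₂ ∨ G.graph.Adj x₁ x₂)
    (hy : y₁ = y₂ ∨ G.graph.Adj y₁ y₂) {z : Plane} (hzx : z ∈ segment ℝ (pos x₁) (pos x₂))
    (hzy : z ∈ segment ℝ (pos y₁) (pos y₂)) : ∃ w, (w = x₁ ∨ w = x₂) ∧ (w = y₁ ∨ w = y₂) := by
  by_cases hz : z ∈ S.points
  · rw [← hA.range_eq] at hz
    obtain ⟨w, rfl⟩ := hz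
    exact ⟨w, hA.eq_or_eq_of_mem_edge hx hzx, hA.eq_or_eq_of_mem_edge hy hzy⟩
  -- If `z` is not a vertex, neither edge is degenerate and both lie on one line, since a point on
  -- two lines is a vertex. Then one edge contains an end of the other.
  · have hedge : ∀ {u v : V}, (u = v ∨ G.graph.Adj u v) → z ∈ segment ℝ (pos u) (pos v) →
        ∃ s ∈ S.lines, pos u ∈ segment ℝ s.1 s.2 ∧ pos v ∈ segment ℝ s.1 s.2 := by
      rintro u v (rfl | h) hzu
      · rw [segment_same] at hzu
        rw [← hA.range_eq] at hz
        exact absurd ⟨u, hzu.symm⟩ hz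
      · exact ((hA.adj_iff _ _).1 h).2.1
    obtain ⟨s, hs, hx1, hx2⟩ := hedge hx hzx
    obtain ⟨t, ht, hy1, hy2⟩ := hedge hy hzy
    by_cases hst : s = t
    · subst hst
      rcases exists_end_mem_segment (S.ne_of_mem_lines hs) hx1 hx2 hy1 hy2 hzx hzy with
        h | h | h | h
      · exact ⟨x₁, Or.inl rfl, hA.eq_or_eq_of_mem_edge hy h⟩
      · exact ⟨x₂, Or.inr rfl, hA.eq_or_eq_of_mem_edge hy h⟩
      · exact ⟨y₁, hA.eq_or_eq_of_mem_edge hx h, Or.inl rfl⟩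
      · exact ⟨y₂, hA.eq_or_eq_of_mem_edge hx h, Or.inr rfl⟩
    · exact absurd (Or.inr ⟨s, hs, t, ht, hst, (convex_segment _ _).segment_subset hx1 hx2 hzx,
        (convex_segment _ _).segment_subset hy1 hy2 hzy⟩) hz

theorem coord_mem_Icc_of_mem_drawing (hA : S.IsArrangement G R pos)
    {X : Set V} {z : Plane} (hz : z ∈ G.drawing pos X)
    (i : Fin 2) : z i ∈ Set.Icc (0 : ℝ) 1 := by
  obtain ⟨x, -, y, -, -, a, b, ha, hb, hab, rfl⟩ := hz
  have hp : ∀ v, pos v i ∈ Set.Icc (0 : ℝ) 1 := fun v =>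
    S.coord_mem_Icc_of_mem_points (hA.range_eq ▸ Set.mem_range_self v) i
  exact convex_Icc (0 : ℝ) 1 (hp x) (hp y) ha hb hab

/-- A set of vertices whose drawing joins the top side to the bottom side meets every set of
vertices whose drawing joins the left side to the right side. -/
theorem inter_nonempty_of_joinedIn (hA : S.IsArrangement G R pos)
    {X Y : Set V} {a b c d : ℝ} (ha : a ∈ S.top) (hb : b ∈ S.bottom)
    (hc : c ∈ S.left) (hd : d ∈ S.right) (hX : JoinedIn (G.drawing pos X) !₂[a, 1] !₂[b, 0])
    (hY : JoinedIn (G.drawing pos Y) !₂[0, c] !₂[1, d]) : (X ∩ Y).Nonempty := by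
  obtain ⟨f, hf⟩ := hX
  obtain ⟨g, hg⟩ := hY
  obtain ⟨s, s', h⟩ := exists_eq_of_crossing_paths f g
    (fun s i => hA.coord_mem_Icc_of_mem_drawing (hf s) i)
    (fun s i => hA.coord_mem_Icc_of_mem_drawing (hg s) i)
    (by simpa using S.top_mem a ha) (by simp) (by simpa using S.bottom_mem b hb) (by simp)
    (by simpa using S.left_mem c hc) (by simp) (by simpa using S.right_mem d hd) (by simp)
  obtain ⟨x₁, hx₁, x₂, hx₂, hx, hzx⟩ := hf s
  obtain ⟨y₁, hy₁, y₂, hy₂, hy, hzy⟩ := hg s'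
  obtain ⟨w, hwx, hwy⟩ := hA.exists_common_end hx hy hzx (h ▸ hzy)
  refine ⟨w, ?_, ?_⟩
  · rcases hwx with rfl | rfl <;> assumption
  · rcases hwy with rfl | rfl <;> assumption

/-- Opposite terminals are joined in a dominating distance-preserving minor by a walk all of whose
vertices are named after vertices of the line between them. -/
theorem exists_walk_on_line (hA : S.IsArrangement G R pos)
    [Finite V] {V' : Finset V} {G' : LenGraph V'}
    (hG' : ∀ u v : V', (u : V) ∈ R → (v : V) ∈ R → G'.d u v = G.d u v) (hdom : G.Dominates G')
    {s : Plane × Plane} (hs : s ∈ S.lines) {u v : V'} (hu : (u : V) ∈ R) (hv : (v : V) ∈ R)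
    (hus : pos u = s.1) (hvs : pos v = s.2) :
    ∃ p : G'.graph.Walk u v, ∀ w ∈ p.support, pos w ∈ segment ℝ s.1 s.2 := by
  classical
  have hd : G'.d u v ≤ nndist (pos u) (pos v) := by
    rw [hG' u v hu hv]
    exact hA.d_le_nndist hs (hus ▸ left_mem_segment ℝ _ _) (hvs ▸ right_mem_segment ℝ _ _)
  obtain ⟨p, hp⟩ := G'.exists_walkLen_eq_d (hd.trans_lt ENNReal.coe_lt_top).ne
  refine ⟨p, fun w hw => ?_⟩
  -- Domination enters here, for vertices that need not be terminals: it bounds both pieces of the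
  -- shortest walk, before and after `w`, below by Euclidean distances.
  have hlow : ∀ {x y : V'} (q : G'.graph.Walk x y),
      nndist (pos x) (pos y) ≤ G'.walkLen q := fun {x y} q =>
    ENNReal.coe_le_coe.1 ((hA.nndist_le_d x y).trans ((hdom x y).trans (G'.d_le_walkLen q)))
  have hsum : nndist (pos u) (pos w) + nndist (pos w) (pos v) ≤ nndist (pos u) (pos v) := by
    refine (add_le_add (hlow (p.takeUntil w hw)) (hlow (p.dropUntil w hw))).trans ?_
    rw [← LenGraph.walkLen_append, p.take_spec hw]
    exact ENNReal.coe_le_coe.1 (hp.trans_le hd)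
  rw [← hus, ← hvs, mem_segment_iff_wbtw, ← dist_add_dist_eq_iff]
  exact le_antisymm (by exact_mod_cast hsum) (dist_triangle _ _ _)

/-- A dominating distance-preserving minor keeps every crossing of a top-bottom line with a
left-right line. -/
theorem exists_vertex_at_crossing (hA : S.IsArrangement G R pos)
    [Finite V] {V' : Finset V} {G' : LenGraph V'}
    (hG' : G.IsDistPreservingMinor R G') (hdom : G.Dominates G') {a b c d : ℝ} (ha : a ∈ S.top)
    (hb : b ∈ S.bottom) (hc : c ∈ S.left) (hd : d ∈ S.right) :
    ∃ v : V', pos v ∈ segment ℝ (!₂[a, 1] : Plane) !₂[b, 0] ∧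
      pos v ∈ segment ℝ (!₂[0, c] : Plane) !₂[1, d] := by
  obtain ⟨⟨B, hconn, hdisj, hadj, hterm⟩, hdist⟩ := hG'
  have hex : ∀ q ∈ S.terminals, ∃ v : V', (v : V) ∈ R ∧ (v : V) ∈ B v ∧ pos v = q := by
    intro q hq
    rw [← hA.terminals_eq] at hq
    obtain ⟨v, hv, rfl⟩ := hq
    obtain ⟨h, h'⟩ := hterm v hv
    exact ⟨⟨v, h⟩, hv, h', rfl⟩
  obtain ⟨t, htR, htB, ht⟩ := hex !₂[a, 1] (Or.inl ⟨a, ha, rfl⟩)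
  obtain ⟨u, huR, huB, hu⟩ := hex !₂[b, 0] (Or.inr (Or.inl ⟨b, hb, rfl⟩))
  obtain ⟨l, hlR, hlB, hl⟩ := hex !₂[0, c] (Or.inr (Or.inr (Or.inl ⟨c, hc, rfl⟩)))
  obtain ⟨r, hrR, hrB, hr⟩ := hex !₂[1, d] (Or.inr (Or.inr (Or.inr ⟨d, hd, rfl⟩)))
  obtain ⟨p, hp⟩ := hA.exists_walk_on_line hdist hdom (s := (!₂[a, 1], !₂[b, 0]))
    (Or.inl ⟨a, ha, b, hb, rfl⟩) htR huR ht hu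
  obtain ⟨q, hq⟩ := hA.exists_walk_on_line hdist hdom (s := (!₂[0, c], !₂[1, d]))
    (Or.inr ⟨c, hc, d, hd, rfl⟩) hlR hrR hl hr
  have hX := G.joinedIn_drawing_of_minor_walk pos hconn hadj p htB huB
  have hY := G.joinedIn_drawing_of_minor_walk pos hconn hadj q hlB hrB
  rw [ht, hu] at hX
  rw [hl, hr] at hY
  obtain ⟨x, hxp, hxq⟩ := hA.inter_nonempty_of_joinedIn ha hb hc hd hX hY
  simp only [Set.mem_iUnion] at hxp hxq
  obtain ⟨v, hv, hxv⟩ := hxp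
  obtain ⟨w, hw, hxw⟩ := hxq
  -- The shared vertex `x` of `G` need not be the crossing; it only identifies the two branch sets.
  -- The crossing is the name of their common vertex `v`.
  have hvw : v = w := by
    by_contra hne
    exact Set.disjoint_left.1 (hdisj v w hne) hxv hxw
  subst hvw
  exact ⟨v, hp v hv, hq v hw⟩

/-- A dominating distance-preserving minor of an arrangement in general position has at least as
many vertices as there are pairs of a top-bottom line and a left-right line. -/
theorem prod_card_le_card (hA : S.IsArrangement G R pos)
    [Finite V] (hS : S.GeneralPosition) {V' : Finset V} {G' : LenGraph V'}
    (hG' : G.IsDistPreservingMinor R G') (hdom : G.Dominates G') :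
    S.top.card * S.bottom.card * (S.left.card * S.right.card) ≤ V'.card := by
  have hex : ∀ x : (S.top ×ˢ S.bottom) ×ˢ (S.left ×ˢ S.right), ∃ v : V',
      pos v ∈ segment ℝ (!₂[x.1.1.1, 1] : Plane) !₂[x.1.1.2, 0] ∧
      pos v ∈ segment ℝ (!₂[0, x.1.2.1] : Plane) !₂[1, x.1.2.2] := by
    rintro ⟨⟨⟨a, b⟩, c, d⟩, hx⟩
    simp only [Finset.mem_product] at hx
    exact hA.exists_vertex_at_crossing hG' hdom hx.1.1 hx.1.2 hx.2.1 hx.2.2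
  choose f hf1 hf2 using hex
  have hinj : Function.Injective f := by
    rintro ⟨⟨⟨a, b⟩, c, d⟩, hx⟩ ⟨⟨⟨a', b'⟩, c', d'⟩, hy⟩ h
    have h1 := hf1 ⟨⟨⟨a, b⟩, c, d⟩, hx⟩
    have h2 := hf2 ⟨⟨⟨a, b⟩, c, d⟩, hx⟩
    have h3 := hf1 ⟨⟨⟨a', b'⟩, c', d'⟩, hy⟩
    have h4 := hf2 ⟨⟨⟨a', b'⟩, c', d'⟩, hy⟩
    rw [← h] at h3 h4
    simp only [Finset.mem_product] at hx hy
    simp only at h1 h2 h3 h4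
    have hnt := S.notMem_terminals
      (S.coord_mem_Ioo_of_crossing hx.1.1 hx.1.2 hx.2.1 hx.2.2 h1 h2)
    have htb : ∀ {a b}, a ∈ S.top → b ∈ S.bottom →
        ((!₂[a, 1], !₂[b, 0]) : Plane × Plane) ∈ S.lines :=
      fun {a b} ha hb => Or.inl ⟨a, ha, b, hb, rfl⟩
    have hlr : ∀ {c d}, c ∈ S.left → d ∈ S.right →
        ((!₂[0, c], !₂[1, d]) : Plane × Plane) ∈ S.lines :=
      fun {c d} hc hd => Or.inr ⟨c, hc, d, hd, rfl⟩
    have hne : ∀ {a} b c d, a ∈ S.top →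
        ((!₂[a, 1], !₂[b, 0]) : Plane × Plane) ≠ (!₂[0, c], !₂[1, d]) := fun {a} b c d ha e =>
      (S.top_mem a ha).1.ne' (by simpa using congrArg (fun s : Plane × Plane => s.1 0) e)
    -- Otherwise two top-bottom lines and a left-right line meet in a point that is not a terminal.
    have e1 : ((!₂[a, 1], !₂[b, 0]) : Plane × Plane) = (!₂[a', 1], !₂[b', 0]) := by
      by_contra hcon
      exact hnt (hS _ (htb hx.1.1 hx.1.2) _ (htb hy.1.1 hy.1.2) _ (hlr hx.2.1 hx.2.2) hcon
        (hne _ _ _ hx.1.1) (hne _ _ _ hy.1.1) _ h1 h3 h2)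
    have e2 : ((!₂[0, c], !₂[1, d]) : Plane × Plane) = (!₂[0, c'], !₂[1, d']) := by
      by_contra hcon
      exact hnt (hS _ (hlr hx.2.1 hx.2.2) _ (hlr hy.2.1 hy.2.2) _ (htb hx.1.1 hx.1.2) hcon
        (hne _ _ _ hx.1.1).symm (hne _ _ _ hx.1.1).symm _ h2 h4 h1)
    obtain rfl : a = a' := by simpa using congrArg (fun s : Plane × Plane => s.1 0) e1
    obtain rfl : b = b' := by simpa using congrArg (fun s : Plane × Plane => s.2 0) e1
    obtain rfl : c = c' := by simpa using congrArg (fun s : Plane × Plane => s.1 1) e2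
    obtain rfl : d = d' := by simpa using congrArg (fun s : Plane × Plane => s.2 1) e2
    rfl
  simpa using Fintype.card_le_of_injective f hinj

end SquareSides.IsArrangement

/-! ### The theorem. -/

theorem mainTheorem4 :
    ∃ c : ℝ, 0 < c ∧ ∀ k : ℕ, ∃ (V : Type) (_ : Fintype V) (G : LenGraph V) (R : Finset V),
      R.card = k ∧ IsGenericSquareArrangement G R ∧
      ∀ (V' : Finset V) (G' : LenGraph V'),
        G.IsDistPreservingMinor R G' → G.Dominates G' → c * (k : ℝ) ^ 4 ≤ (V'.card : ℝ) := by
  classical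
  -- Here `4096 = 8 ^ 4`, because `k / 4` rounded down is at least `k / 8` once `k ≥ 4`.
  refine ⟨1 / 4096, by norm_num, fun k => ?_⟩
  obtain ⟨S, hS, h1, h2, h3, h4⟩ :=
    -- The top side takes the remainder, so that there are exactly `k` terminals.
    SquareSides.exists_generalPosition (k - 3 * (k / 4)) (k / 4) (k / 4) (k / 4)
  have := S.finite_points.fintype
  let R : Finset S.points := Finset.univ.filter fun u => (u : Plane) ∈ S.terminals
  have hA : S.IsArrangement S.arrangement R Subtype.val :=
    S.isArrangement_arrangement R fun u => by simp [R]
  have hR : R.card = k := by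
    rw [← Set.ncard_coe_finset, ← Set.ncard_image_of_injective _ Subtype.val_injective,
      hA.terminals_eq, S.ncard_terminals, h1, h2, h3, h4]
    omega
  refine ⟨S.points, this, S.arrangement, R, hR,
    ⟨S, Subtype.val, hA, hS, by omega, by omega, by omega, by omega⟩, fun V' G' hG' hdom => ?_⟩
  -- For `k < 4` the product bound may vanish, but the `k` surviving terminals already suffice.
  rcases lt_or_ge k 4 with hk | hk
  · have hsub : R ⊆ V' := fun t ht => by
      obtain ⟨⟨B, -, -, -, hterm⟩, -⟩ := hG'
      exact (hterm t ht).1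
    have hcard : k ≤ V'.card := hR ▸ Finset.card_le_card hsub
    have hcard' : (k : ℝ) ≤ V'.card := by exact_mod_cast hcard
    have hk4 : (k : ℝ) ≤ 4 := by exact_mod_cast hk.le
    calc 1 / 4096 * (k : ℝ) ^ 4 = 1 / 4096 * ((k : ℝ) ^ 3 * k) := by ring
      _ ≤ 1 / 4096 * ((4 : ℝ) ^ 3 * k) := by gcongr
      _ ≤ k := by linarith [(Nat.cast_nonneg k : (0 : ℝ) ≤ k)]
      _ ≤ V'.card := hcard'
  · have hprod := hA.prod_card_le_card hS hG' hdom
    have hle : (k / 4) ^ 4 ≤ V'.card := by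
      refine le_trans ?_ hprod
      rw [h2, h3, h4]
      calc (k / 4) ^ 4 = k / 4 * (k / 4) * (k / 4 * (k / 4)) := by ring
        _ ≤ _ := by gcongr; omega
    have hk8 : (k : ℝ) / 8 ≤ ((k / 4 : ℕ) : ℝ) := by
      rw [div_le_iff₀ (by norm_num)]
      exact_mod_cast (by omega : k ≤ k / 4 * 8)
    calc 1 / 4096 * (k : ℝ) ^ 4 = ((k : ℝ) / 8) ^ 4 := by ring
      _ ≤ ((k / 4 : ℕ) : ℝ) ^ 4 := by gcongr
      _ ≤ V'.card := by exact_mod_cast hle
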